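/- A $3$-graph is a hypergraph all of whose hyperedges have exactly three vertices; write $xyz$ for $\{x,y,z\}$. For $3$-graphs $F,H$ write $F\subseteq H$ if $H$ contains a copy of $F$, i.e. there is an injection $V(F)\to V(H)$ mapping every hyperedge of $F$ onto a hyperedge of $H$; otherwise $H$ is $F$-free. Let $\mathrm{ex}(n,F)$ be the maximum number of hyperedges of an $F$-free $3$-graph on $n$ vertices. Let $F[t]$ be the $t$-blow-up of $F$: each vertex $v$ is replaced by a set $S_v$ of $t$ vertices (the sets $S_v$ being pairwise disjoint), and each hyperedge $uvw$ by all triples with exactly one vertex in each of $S_u,S_v,S_w$. Let $S(n)$ be the complete tripartite $3$-graph on $n$ vertices with parts $V_1,V_2,V_3$ of sizes as equal as possible, and let $s(n)=\lfloor n/3\rfloor\lfloor (n+1)/3\rfloor\lfloor (n+2)/3\rfloor$ be its number of hyperedges. For $m\ge 1$ let $S^+(m)$ be a $3$-graph obtained from $S(m-1)$ by adding a new vertex $v$ and one hyperedge consisting of $v$ and two distinct vertices of the same part of $S(m-1)$ (whenever some part has two vertices). Let $F_5$ be the $3$-graph on vertex set $\{1,2,3,4,5\}$ with hyperedges $123,124,345$,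 and let $F_5'$ be the $3$-graph on vertex set $\{1,2,3,3',4,4',5\}$ with hyperedges $123,124,345,3'4'5$. Then: 1. $F_5\subseteq F_5'\subseteq F_5[2]$; 2. $F_5'\not\subseteq S^+(m)$ for every $m\ge 1$ (and every choice of the two vertices of $S(m-1)$ in the added hyperedge); 3. there is $N$ such that $\mathrm{ex}(n,F_5')=s(n)$ for all $n\ge N$. -/

import Mathlib

namespace ThreeGraphs

/-- A hypergraph all of whose hyperedges have exactly three vertices (a `3`-graph). -/
def IsThreeUniform {α : Type*} (H : Hypergraph α) : Prop :=
  ∀ e ∈ H.edgeSet, e.ncard = 3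

/-- `F` is a subhypergraph of `H` up to isomorphism: `H` contains a copy of `F`, given by an
injection of the vertices of `F` into those of `H` that takes hyperedges to hyperedges. -/
def ContainsCopy {α β : Type*} (F : Hypergraph α) (H : Hypergraph β) : Prop :=
  ∃ f : α → β, Set.InjOn f F.vertexSet ∧ Set.MapsTo f F.vertexSet H.vertexSet ∧
    ∀ e ∈ F.edgeSet, f '' e ∈ H.edgeSet

/-- The numbers of hyperedges of the `F`-free `3`-graphs with vertex set `Fin n`. -/
def freeSizes {α : Type*} (n : ℕ) (F : Hypergraph α) : Set ℕ :=
  {k | ∃ H : Hypergraph (Fin n), H.vertexSet = Set.univ ∧ IsThreeUniform H ∧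
    ¬ ContainsCopy F H ∧ H.edgeSet.ncard = k}

/-- The Turán number `ex(n, F)`: the maximum number of hyperedges of an `F`-free `3`-graph on
`n` vertices. -/
noncomputable def ex {α : Type*} (n : ℕ) (F : Hypergraph α) : ℕ :=
  sSup (freeSizes n F)

/-- The supremum in the definition of `ex n F` is a genuine maximum if `F` has a hyperedge. -/
theorem isGreatest_ex {α : Type*} (n : ℕ) (F : Hypergraph α) (hF : F.edgeSet.Nonempty) :
    IsGreatest (freeSizes n F) (ex n F) := by
  have hne : (freeSizes n F).Nonempty := by
    refine ⟨0, Hypergraph.trivialOn Set.univ, rfl, ?_, ?_, ?_⟩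
    · intro e he
      simp at he
    · rintro ⟨f, -, -, h⟩
      obtain ⟨e, he⟩ := hF
      simpa using h e he
    · simp
  have hbdd : BddAbove (freeSizes n F) := by
    refine ⟨Nat.card (Set (Fin n)), ?_⟩
    rintro k ⟨H, -, -, -, rfl⟩
    exact Set.ncard_le_card H.edgeSet
  exact ⟨Nat.sSup_mem hne hbdd, fun k hk => le_csSup hbdd hk⟩

/-- The generalized triangle `F₅`. -/
def F5 : Hypergraph ℕ where
  vertexSet := {1, 2, 3, 4, 5}
  edgeSet := {{1, 2, 3}, {1, 2, 4}, {3, 4, 5}}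
  subset_vertexSet_of_mem_edgeSet' := by
    rintro e (rfl | rfl | rfl) x hx <;> simp at hx ⊢ <;> omega

/-- The hypergraph `F₅′`; the vertices `3′` and `4′` are written `6` and `7`. -/
def F5Prime : Hypergraph ℕ where
  vertexSet := {1, 2, 3, 6, 4, 7, 5}
  edgeSet := {{1, 2, 3}, {1, 2, 4}, {3, 4, 5}, {6, 7, 5}}
  subset_vertexSet_of_mem_edgeSet' := by
    rintro e (rfl | rfl | rfl | rfl) x hx <;> simp at hx ⊢ <;> omega

/-- The `t`-blow-up `F[t]`: every vertex `v` is replaced by the `t` vertices `(v, i)`, and every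
hyperedge by all sets that consist of exactly one copy of each of its vertices. -/
def blowUp {α : Type*} (F : Hypergraph α) (t : ℕ) : Hypergraph (α × Fin t) where
  vertexSet := {p | p.1 ∈ F.vertexSet}
  edgeSet := {e | Set.InjOn Prod.fst e ∧ Prod.fst '' e ∈ F.edgeSet}
  subset_vertexSet_of_mem_edgeSet' := by
    rintro e ⟨-, he⟩ p hp
    exact F.subset_vertexSet_of_mem_edgeSet' he ⟨p, hp, rfl⟩

/-- The part of a vertex in the balanced partition of `Fin n` into three parts, the residue
classes modulo `3`; their sizes are `⌊(n+2)/3⌋`, `⌊(n+1)/3⌋` and `⌊n/3⌋`. -/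
def part {n : ℕ} (x : Fin n) : ℕ := x.val % 3

/-- The balanced complete tripartite `3`-graph `S(n)` on `n` vertices. -/
def S (n : ℕ) : Hypergraph (Fin n) where
  vertexSet := Set.univ
  edgeSet := {e | ∃ x y z : Fin n, part x = 0 ∧ part y = 1 ∧ part z = 2 ∧ e = {x, y, z}}
  subset_vertexSet_of_mem_edgeSet' := fun _ _ => Set.subset_univ _

/-- `s(n)`, the number of hyperedges of `S(n)`. -/
def s (n : ℕ) : ℕ := (n / 3) * ((n + 1) / 3) * ((n + 2) / 3)

/-- The hypergraph `S⁺(m)`, for `m ≥ 1` and two distinct vertices `x`, `y` in one part of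
`S(m - 1)`: the new vertex `v = none` and the hyperedge `vxy` are added to `S(m - 1)`. -/
def SPlus (m : ℕ) (x y : Fin (m - 1)) : Hypergraph (Option (Fin (m - 1))) where
  vertexSet := Set.univ
  edgeSet := {e | ∃ d ∈ (S (m - 1)).edgeSet, e = some '' d} ∪ {{none, some x, some y}}
  subset_vertexSet_of_mem_edgeSet' := fun _ _ => Set.subset_univ _

end ThreeGraphs

/-!
The `3`-graph `F₅′` is `F₅` with the pendant hyperedge `3′4′5` attached at `5`. In `S⁺(m)` only
this pendant hyperedge could use the new vertex, so a copy of `F₅′` would leave a copy of `F₅` in a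
tripartite `3`-graph, which is impossible (`not_F5_hom_S`).

For the Turán number, the lower bound comes from `S(n)`. For the upper bound, deleting vertices
whose degree is below `s(n) - s(n - 1)` increases the excess over `s(n)`, so it suffices to treat
`3`-graphs in which every degree is at least that value, about `n² / 9`
(`F5PrimeFree.total_le_add`). Then every vertex lies in a hyperedge whose other two vertices avoid
any four given ones. So the pendant hyperedge is always available, and the `3`-graph is `F₅`-free
(`F5PrimeFree.f5Free`).

An `F₅`-free `3`-graph with this minimum degree is tripartite (`F5Free.exists_tripartition`).
The main tool is that two vertices of `N(xy)`, the set of third vertices of the hyperedges through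
`x` and `y`, are in hyperedges only with `x` or `y`. Let `A = N(xy)` have maximum size. Counting the
link of a vertex `z ∈ A` gives `|A| ≥ n / 3` approximately. An averaging argument chooses `z` so
that few pairs in its link have codegree at most two. Without these pairs the link is
triangle-free and lives essentially outside `A`, on about `2n / 3` vertices. Having about `n² / 9`
edges, it is nearly a balanced complete bipartite graph by the stability form of Mantel's theorem.
This yields an approximate tripartition, and comparing links makes it exact
(`exists_tripartition_of_parts`). Finally, a tripartite `3`-graph has at most `s(n)` hyperedges
(`mul_mul_le_s`).
-/

namespace ThreeGraphs

open Finset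

/-! ### Triple systems, links and degrees -/

/-- A `3`-graph on `V`, given by the relation "`a`, `b`, `c` are the vertices of a hyperedge". -/
structure TripleSystem (V : Type*) where
  Rel : V → V → V → Prop
  swap : ∀ {a b c : V}, Rel a b c → Rel b a c
  rotate : ∀ {a b c : V}, Rel a b c → Rel b c a
  ne : ∀ {a b c : V}, Rel a b c → a ≠ b

namespace TripleSystem

variable {V : Type*} (T : TripleSystem V)

/-- No five distinct vertices span a copy of `F₅`. The relation already forces all
coincidences apart from `e = a` and `e = b` to fail. -/
def F5Free : Prop :=
  ∀ ⦃a b c d e : V⦄, T.Rel a b c → T.Rel a b d → T.Rel c d e → e = a ∨ e = b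

/-- No seven distinct vertices span a copy of `F₅′`. -/
def F5PrimeFree : Prop :=
  ∀ ⦃a b c d e p q : V⦄, T.Rel a b c → T.Rel a b d → T.Rel c d e → e ≠ a → e ≠ b →
    T.Rel e p q → p ∈ ({a, b, c, d} : Set V) ∨ q ∈ ({a, b, c, d} : Set V)

variable {T} in
lemma swap_right {a b c : V} (h : T.Rel a b c) : T.Rel a c b :=
  T.rotate (T.rotate (T.swap (T.rotate h)))

open Classical in
/-- The ordered pairs in the link of `v` that belong to `X × Y`. -/
noncomputable def cross (v : V) (X Y : Finset V) : Finset (V × V) :=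
  (X ×ˢ Y).filter fun p => T.Rel v p.1 p.2

variable {T} in
@[simp] lemma mem_cross {v : V} {X Y : Finset V} {p : V × V} :
    p ∈ T.cross v X Y ↔ (p.1 ∈ X ∧ p.2 ∈ Y) ∧ T.Rel v p.1 p.2 := by simp [cross]

variable {T} in
/-- Two vertices whose links share two disjoint pairs lie in no common hyperedge of an `F₅`-free
`3`-graph: by `F5Free` its third vertex would belong to both pairs. The numerical hypothesis
produces two such pairs. -/
lemma F5Free.not_rel_of_card_lt (hT : T.F5Free) {X Y : Finset V} (hXY : Disjoint X Y) {u v w : V}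
    (h : #X * #Y + #X + #Y < #(T.cross u X Y) + #(T.cross v X Y)) : ¬ T.Rel u v w := by
  classical
  intro huv
  have hU : #(T.cross u X Y ∪ T.cross v X Y) ≤ #X * #Y := by
    rw [← Finset.card_product]
    refine Finset.card_le_card fun p hp => ?_
    rcases mem_union.1 hp with hp | hp <;> exact mem_product.2 (mem_cross.1 hp).1
  have hI := Finset.card_union_add_card_inter (T.cross u X Y) (T.cross v X Y)
  set I := T.cross u X Y ∩ T.cross v X Y with hIdef
  have hIne : I.Nonempty := by
    rw [← Finset.card_pos]
    omega
  obtain ⟨p, hp⟩ := hIne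
  obtain ⟨q, hq, hqp⟩ : ∃ q ∈ I, q ∉ ({p.1} ×ˢ Y) ∪ (X ×ˢ {p.2}) := by
    by_contra! hcon
    have h1 := Finset.card_le_card (show I ⊆ ({p.1} ×ˢ Y) ∪ (X ×ˢ {p.2}) from hcon)
    have h2 := h1.trans (Finset.card_union_le _ _)
    simp only [card_product, card_singleton] at h2
    omega
  simp only [hIdef, mem_inter, mem_cross] at hp hq
  simp only [mem_union, mem_product, mem_singleton, not_or, not_and] at hqp
  have hw1 := hT (T.rotate hp.1.2) (T.rotate hp.2.2) huv
  have hw2 := hT (T.rotate hq.1.2) (T.rotate hq.2.2) huv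
  have hd : ∀ x ∈ X, ∀ y ∈ Y, x ≠ y := fun x hx y hy e =>
    (Finset.disjoint_left.1 hXY hx) (e ▸ hy)
  have e1 := hd _ hp.1.1.1 _ hq.1.1.2
  have e2 := hd _ hq.1.1.1 _ hp.1.1.2
  have e3 : q.1 ≠ p.1 := fun e => hqp.1 e hq.1.1.2
  have e4 : q.2 ≠ p.2 := fun e => hqp.2 hq.1.1.1 e
  rcases hw1 with rfl | rfl <;> rcases hw2 with h | h
  · exact e3 h.symm
  · exact e1 h
  · exact e2 h.symm
  · exact e4 h.symm

section Counting

variable [Fintype V]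

open Classical in
/-- The set of vertices that form a hyperedge with `u` and `v`. -/
noncomputable def nbr (u v : V) : Finset V := univ.filter (T.Rel u v)

open Classical in
/-- The link of `v`, as a set of ordered pairs. -/
noncomputable def link (v : V) : Finset (V × V) := univ.filter fun p => T.Rel v p.1 p.2

/-- The number of ordered pairs in the link of `v`: twice the degree. -/
noncomputable def deg (v : V) : ℕ := #(T.link v)

/-- The number of ordered triples that form a hyperedge: six times the number of hyperedges. -/
noncomputable def total : ℕ := ∑ v, T.deg v

variable {T}

@[simp] lemma mem_nbr {u v w : V} : w ∈ T.nbr u v ↔ T.Rel u v w := by simp [nbr]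

@[simp] lemma mem_link {v : V} {p : V × V} : p ∈ T.link v ↔ T.Rel v p.1 p.2 := by simp [link]

variable (T)

lemma deg_eq_sum_card_nbr (v : V) : T.deg v = ∑ w, #(T.nbr v w) := by
  classical
  rw [deg, Finset.card_eq_sum_card_fiberwise (f := Prod.fst) (t := univ) (by simp)]
  refine Finset.sum_congr rfl fun w _ => ?_
  refine Finset.card_bij' (fun p _ => p.2) (fun x _ => (w, x)) ?_ ?_ ?_ ?_
  · rintro ⟨a, b⟩ h
    simp only [mem_filter, mem_link] at h
    rw [mem_nbr, ← h.2]
    exact h.1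
  · intro x hx
    simpa using hx
  · rintro ⟨a, b⟩ h
    simp only [mem_filter] at h
    simp [h.2]
  · simp

/-- Each of the at most `n ^ 2` ordered pairs of codegree at most two lies in at most two links. -/
lemma sum_card_low_link_le :
    ∑ z, #{p ∈ T.link z | #(T.nbr p.1 p.2) ≤ 2} ≤ 2 * Fintype.card V ^ 2 := by
  classical
  have h := Finset.sum_card_bipartiteAbove_eq_sum_card_bipartiteBelow
    (s := (univ : Finset V)) (t := (univ : Finset (V × V)).filter fun p => #(T.nbr p.1 p.2) ≤ 2)
    (fun z p => T.Rel z p.1 p.2)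
  have h1 : ∀ z, #{p ∈ T.link z | #(T.nbr p.1 p.2) ≤ 2} =
      #(bipartiteAbove (fun z (p : V × V) => T.Rel z p.1 p.2)
        ((univ : Finset (V × V)).filter fun p => #(T.nbr p.1 p.2) ≤ 2) z) := by
    intro z
    congr 1
    ext p
    simp [bipartiteAbove, and_comm]
  rw [Finset.sum_congr rfl fun z _ => h1 z, h]
  calc _ ≤ ∑ p ∈ (univ : Finset (V × V)).filter fun p => #(T.nbr p.1 p.2) ≤ 2, 2 := by
        refine Finset.sum_le_sum fun p hp => ?_
        refine le_trans (Finset.card_le_card ?_) (mem_filter.1 hp).2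
        intro z hz
        simp only [bipartiteBelow, mem_filter, mem_univ, true_and] at hz
        exact mem_nbr.2 (T.rotate hz)
    _ ≤ _ := by
        rw [Finset.sum_const, smul_eq_mul, mul_comm]
        refine Nat.mul_le_mul_left _ ((Finset.card_le_univ _).trans ?_)
        simp [sq]

variable {T}

/-- If no link pair of `u` lies inside one of three sets, then all link pairs of `u` touch the
remainder `R` or are crossing. -/
lemma deg_le_card_cross (P : Fin 3 → Finset V) (R : Finset V) (hR : ∀ v, v ∈ R ∨ ∃ i, v ∈ P i)
    {u : V} (hu : ∀ i, ∀ a ∈ P i, ∀ b ∈ P i, ¬ T.Rel u a b) :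
    T.deg u ≤ 2 * (#R * Fintype.card V) + 2 * ∑ i, #(T.cross u (P (i + 1)) (P (i + 2))) := by
  classical
  have hsub : T.link u ⊆ ((R ×ˢ univ) ∪ (univ ×ˢ R)) ∪
      ((univ.biUnion fun i => T.cross u (P (i + 1)) (P (i + 2))) ∪
        (univ.biUnion fun i => T.cross u (P (i + 1)) (P (i + 2))).image Prod.swap) := by
    rintro ⟨a, b⟩ hab
    rw [mem_link] at hab
    simp only [mem_union, mem_product, mem_univ, and_true, true_and, mem_biUnion, mem_cross,
      mem_image, Prod.exists, Prod.swap_prod_mk, Prod.mk.injEq]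
    rcases hR a with ha | ⟨i, ha⟩
    · exact Or.inl (Or.inl ha)
    rcases hR b with hb | ⟨j, hb⟩
    · exact Or.inl (Or.inr hb)
    right
    have hij : i ≠ j := by
      rintro rfl
      exact hu i a ha b hb hab
    have key : ∀ i j : Fin 3, i ≠ j →
        (∃ k : Fin 3, k + 1 = i ∧ k + 2 = j) ∨ (∃ k : Fin 3, k + 1 = j ∧ k + 2 = i) := by decide
    rcases key i j hij with ⟨k, rfl, rfl⟩ | ⟨k, rfl, rfl⟩
    · exact Or.inl ⟨k, ⟨ha, hb⟩, hab⟩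
    · exact Or.inr ⟨b, a, ⟨k, ⟨hb, ha⟩, T.swap_right hab⟩, rfl, rfl⟩
  have h1 : #(univ.biUnion fun i => T.cross u (P (i + 1)) (P (i + 2))) ≤
      ∑ i, #(T.cross u (P (i + 1)) (P (i + 2))) := Finset.card_biUnion_le
  have h2 := (Finset.card_le_card hsub).trans ((Finset.card_union_le _ _).trans
    (add_le_add (Finset.card_union_le _ _) ((Finset.card_union_le _ _).trans
      (add_le_add h1 (Finset.card_image_le.trans h1)))))
  simp only [card_product, card_univ] at h2
  rw [deg]
  linarith [mul_comm #R (Fintype.card V)]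

end Counting

end TripleSystem

/-! ### From an approximate to an exact tripartition -/

namespace TripleSystem

variable {V : Type*} [Fintype V] {T : TripleSystem V}

/-- An approximate tripartition of an `F₅`-free `3`-graph of large minimum degree, in which
hyperedges with two vertices in one part end in the small remainder `R`, yields an exact
tripartition. A vertex of `P i` has almost its entire link in `P (i + 1) × P (i + 2)`, so vertices
of one part are twins in the sense of `not_rel_of_card_lt`. Any vertex `v` has at least a third of
its link in one of these products; `v` is then a twin of every vertex of `P i`, which rules out the
other two products, and so `v` too has almost its entire link in the first. -/
theorem exists_tripartition_of_parts (hT : T.F5Free) (hn : (10 : ℝ) ^ 6 ≤ Fintype.card V)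
    (hdeg : ∀ v, (2 / 9 - 1 / 20000) * (Fintype.card V : ℝ) ^ 2 ≤ T.deg v)
    (P : Fin 3 → Finset V) (R : Finset V) (hR : ∀ v, v ∈ R ∨ ∃ i, v ∈ P i)
    (hdisj : ∀ i j, i ≠ j → Disjoint (P i) (P j))
    (hRcard : (#R : ℝ) ≤ Fintype.card V / 100)
    (hprod : ∀ i, (#(P (i + 1)) : ℝ) * #(P (i + 2)) ≤ 12 / 100 * (Fintype.card V : ℝ) ^ 2)
    (hP : ∀ i, ∀ a ∈ P i, ∀ b ∈ P i, ∀ w, T.Rel a b w → ∀ j, w ∉ P j) :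
    ∃ p : V → Fin 3, ∀ u v w, T.Rel u v w → p u ≠ p v := by
  classical
  set n : ℝ := (Fintype.card V : ℝ) with hndef
  have hsucc : ∀ i : Fin 3, i + 1 ≠ i ∧ i + 2 ≠ i ∧ i + 1 ≠ i + 2 := by decide
  have hcover : ∀ i j : Fin 3, i ≠ j → i = j + 1 ∨ i = j + 2 := by decide
  have hle : ∀ i, (#(P i) : ℝ) ≤ n := fun i =>
    Nat.cast_le.2 (Finset.card_le_univ (P i))
  -- the size condition of `not_rel_of_card_lt`, over the reals
  have twin : ∀ i u v w, (2 / 9 - 1 / 20000 - 2 / 100) / 2 * n ^ 2 ≤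
        #(T.cross u (P (i + 1)) (P (i + 2))) →
      (2 / 9 - 1 / 20000 - 2 / 100) / 6 * n ^ 2 ≤ #(T.cross v (P (i + 1)) (P (i + 2))) →
      ¬ T.Rel u v w := by
    intro i u v w hu hv
    refine hT.not_rel_of_card_lt (hdisj _ _ (hsucc i).2.2) ?_
    rw [← Nat.cast_lt (α := ℝ)]
    push_cast
    nlinarith [hprod i, hle (i + 1), hle (i + 2)]
  have hdeg' : ∀ u, (∀ i, ∀ a ∈ P i, ∀ b ∈ P i, ¬ T.Rel u a b) →
      (2 / 9 - 1 / 20000 - 2 / 100) / 2 * n ^ 2 ≤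
        ∑ i, (#(T.cross u (P (i + 1)) (P (i + 2))) : ℝ) := by
    intro u hu
    have h := deg_le_card_cross P R hR hu
    rw [← Nat.cast_le (α := ℝ)] at h
    push_cast at h
    nlinarith [hdeg u]
  have hpart : ∀ i, ∀ u ∈ P i, (2 / 9 - 1 / 20000 - 2 / 100) / 2 * n ^ 2 ≤
      #(T.cross u (P (i + 1)) (P (i + 2))) := by
    intro i u hu
    have h := hdeg' u fun j a ha b hb hab => hP j a ha b hb u (T.rotate hab) i hu
    rw [Finset.sum_eq_single i] at h
    · exact h
    · intro j _ hj
      rw [Nat.cast_eq_zero, Finset.card_eq_zero, Finset.eq_empty_iff_forall_notMem]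
      rintro ⟨a, b⟩ hab
      simp only [mem_cross] at hab
      obtain ⟨⟨ha, hb⟩, hab⟩ := hab
      rcases hcover i j hj.symm with rfl | rfl
      · exact hP _ _ hu _ ha b hab _ hb
      · exact hP _ _ hu _ hb a (T.swap_right hab) _ ha
    · simp
  have hinner : ∀ i, ∀ a ∈ P i, ∀ b ∈ P i, ∀ w, ¬ T.Rel a b w := by
    intro i a ha b hb w
    refine twin i a b w (hpart i a ha) (le_trans ?_ (hpart i b hb))
    nlinarith [sq_nonneg n]
  have htype : ∀ v, ∃ i, (2 / 9 - 1 / 20000 - 2 / 100) / 2 * n ^ 2 ≤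
      (#(T.cross v (P (i + 1)) (P (i + 2))) : ℝ) := by
    intro v
    have h := hdeg' v fun i a ha b hb hab => hinner i a ha b hb v (T.rotate hab)
    obtain ⟨i, hi⟩ : ∃ i, (2 / 9 - 1 / 20000 - 2 / 100) / 6 * n ^ 2 ≤
        (#(T.cross v (P (i + 1)) (P (i + 2))) : ℝ) := by
      by_contra! hcon
      have := Finset.sum_lt_sum_of_nonempty (univ_nonempty (α := Fin 3)) fun i _ => hcon i
      simp only [sum_const, card_univ, Fintype.card_fin, nsmul_eq_mul] at this
      push_cast at this
      linarith
    refine ⟨i, ?_⟩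
    rwa [Finset.sum_eq_single i] at h
    · intro j _ hj
      rw [Nat.cast_eq_zero, Finset.card_eq_zero, Finset.eq_empty_iff_forall_notMem]
      rintro ⟨a, b⟩ hab
      simp only [mem_cross] at hab
      obtain ⟨⟨ha, hb⟩, hab⟩ := hab
      -- a crossing pair of another type meets `P i`, whose vertices are twins of `v`
      rcases hcover i j hj.symm with rfl | rfl
      · exact twin _ a v b (hpart _ a ha) hi (T.swap hab)
      · exact twin _ b v a (hpart _ b hb) hi (T.swap (T.swap_right hab))
    · simp
  choose p hp using htype
  refine ⟨p, fun u v w huv he => ?_⟩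
  refine twin (p u) u v w (hp u) (le_trans ?_ (he ▸ hp v)) huv
  nlinarith [sq_nonneg n]

variable (T) in
open Classical in
lemma total_eq_card :
    T.total = #((univ : Finset (V × V × V)).filter fun t => T.Rel t.1 t.2.1 t.2.2) := by
  rw [total, Finset.card_eq_sum_card_fiberwise (f := Prod.fst) (t := univ) (by simp)]
  refine Finset.sum_congr rfl fun v _ => ?_
  refine Finset.card_bij' (fun q _ => (v, q)) (fun t _ => t.2) ?_ ?_ ?_ ?_
  · intro q hq
    simpa using hq
  · rintro ⟨a, q⟩ h
    simp only [mem_filter] at h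
    rw [mem_link, ← h.2]
    exact h.1.2
  · simp
  · rintro ⟨a, q⟩ h
    simp only [mem_filter] at h
    simp [h.2]

/-- A tripartite `3`-graph has at most as many hyperedges as the product of its part sizes. -/
lemma total_le_of_tripartite (p : V → Fin 3) (hp : ∀ u v w, T.Rel u v w → p u ≠ p v) :
    T.total ≤ 6 * (#{v | p v = 0} * #{v | p v = 1} * #{v | p v = 2}) := by
  classical
  set c : Fin 3 → ℕ := fun i => #{v | p v = i} with hc
  rw [total_eq_card]
  let K : Finset (Fin 3 × Fin 3 × Fin 3) :=
    univ.filter fun t => t.1 ≠ t.2.1 ∧ t.2.1 ≠ t.2.2 ∧ t.2.2 ≠ t.1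
  rw [Finset.card_eq_sum_card_fiberwise (f := fun t => (p t.1, p t.2.1, p t.2.2)) (t := K)]
  · have hK : ∀ t ∈ K, c t.1 * (c t.2.1 * c t.2.2) = c 0 * c 1 * c 2 := by
      rintro ⟨i, j, k⟩ ht
      simp only [K, mem_filter, mem_univ, true_and] at ht
      obtain ⟨h1, h2, h3⟩ := ht
      fin_cases i <;> fin_cases j <;> fin_cases k <;> simp at h1 h2 h3 <;> simp <;> ring
    have hKc : #K = 6 := by decide
    calc _ ≤ ∑ t ∈ K, c t.1 * (c t.2.1 * c t.2.2) := by
          refine Finset.sum_le_sum fun t _ => ?_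
          simp only [hc, ← Finset.card_product]
          refine Finset.card_le_card ?_
          rintro ⟨a, b, d⟩ h
          simp only [mem_filter] at h
          simp [← h.2]
      _ = _ := by
          rw [Finset.sum_congr rfl hK, Finset.sum_const, hKc, smul_eq_mul]
  · rintro ⟨a, b, d⟩ h
    simp only [coe_filter, mem_univ, true_and, Set.mem_ofPred_eq] at h
    simp only [K, coe_filter, mem_univ, true_and, Set.mem_ofPred_eq]
    exact ⟨hp _ _ _ h, hp _ _ _ (T.rotate h), hp _ _ _ (T.rotate (T.rotate h))⟩

end TripleSystem

/-- Among triples with sum `n`, the balanced one has the largest product. -/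
lemma mul_mul_le_s (a b c : ℕ) : a * b * c ≤ s (a + b + c) := by
  induction a generalizing b c with
  | zero => simp
  | succ a ih =>
    rcases b with _ | b
    · simp
    rcases c with _ | c
    · simp
    have h := ih b c
    rw [show a + 1 + (b + 1) + (c + 1) = (a + b + c) + 3 by ring]
    have hpair : 3 * (a * b + b * c + c * a) ≤ (a + b + c) ^ 2 := by
      zify
      nlinarith [sq_nonneg ((a : ℤ) - b), sq_nonneg ((b : ℤ) - c), sq_nonneg ((c : ℤ) - a)]
    have hexp : (a + 1) * (b + 1) * (c + 1) =
        a * b * c + (a * b + b * c + c * a) + (a + b + c) + 1 := by ring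
    rw [hexp]
    generalize a + b + c = m at h hpair ⊢
    unfold s at h ⊢
    obtain ⟨q, hq | hq | hq⟩ : ∃ q, m = 3 * q ∨ m = 3 * q + 1 ∨ m = 3 * q + 2 :=
      ⟨m / 3, by omega⟩
    · subst hq
      rw [show (3 * q + 3) / 3 = q + 1 by omega, show (3 * q + 3 + 1) / 3 = q + 1 by omega,
        show (3 * q + 3 + 2) / 3 = q + 1 by omega]
      rw [show (3 * q) / 3 = q by omega, show (3 * q + 1) / 3 = q by omega,
        show (3 * q + 2) / 3 = q by omega] at h
      nlinarith
    · subst hq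
      rw [show (3 * q + 1 + 3) / 3 = q + 1 by omega, show (3 * q + 1 + 3 + 1) / 3 = q + 1 by omega,
        show (3 * q + 1 + 3 + 2) / 3 = q + 2 by omega]
      rw [show (3 * q + 1) / 3 = q by omega, show (3 * q + 1 + 1) / 3 = q by omega,
        show (3 * q + 1 + 2) / 3 = q + 1 by omega] at h
      have : a * b + b * c + c * a ≤ 3 * q ^ 2 + 2 * q := by
        by_contra! hcon
        nlinarith
      nlinarith
    · subst hq
      rw [show (3 * q + 2 + 3) / 3 = q + 1 by omega, show (3 * q + 2 + 3 + 1) / 3 = q + 2 by omega,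
        show (3 * q + 2 + 3 + 2) / 3 = q + 2 by omega]
      rw [show (3 * q + 2) / 3 = q by omega, show (3 * q + 2 + 1) / 3 = q + 1 by omega,
        show (3 * q + 2 + 2) / 3 = q + 1 by omega] at h
      have : a * b + b * c + c * a ≤ 3 * q ^ 2 + 4 * q + 1 := by
        by_contra! hcon
        nlinarith
      nlinarith

/-! ### The structure of `F₅`-free `3`-graphs of large minimum degree -/

/-- Stability form of Mantel's theorem: in a triangle-free graph, the neighbourhood `B` of a
vertex of maximum degree spans no edge, so the number of edges is at most `|B|(n - |B|)`; and what
the bipartite graph between `B` and its complement misses is bounded by what is missing from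
that bound. Edges of the graph are counted as ordered pairs. -/
lemma exists_nbhd_of_triangleFree {V : Type*} [DecidableEq V] (W : Finset V) (G : V → V → Prop)
    [DecidableRel G] (htri : ∀ a b c, G a b → G a c → ¬ G b c) (hW : W.Nonempty) :
    ∃ v ∈ W, #{e ∈ W ×ˢ W | G e.1 e.2} ≤
      #{e ∈ ({u ∈ W | G v u}) ×ˢ (W \ {u ∈ W | G v u}) | G e.1 e.2} +
        #{u ∈ W | G v u} * #(W \ {u ∈ W | G v u}) := by
  obtain ⟨v, hv, hmax⟩ := Finset.exists_max_image W (fun v => #{u ∈ W | G v u}) hW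
  refine ⟨v, hv, ?_⟩
  set B := {u ∈ W | G v u} with hB
  have hBW : B ⊆ W := Finset.filter_subset _ _
  have hsub : {e ∈ W ×ˢ W | G e.1 e.2} ⊆
      {e ∈ B ×ˢ (W \ B) | G e.1 e.2} ∪ (W \ B).biUnion fun u => {u} ×ˢ {x ∈ W | G u x} := by
    rintro ⟨a, b⟩ hab
    simp only [mem_filter, mem_product] at hab
    simp only [mem_union, mem_filter, mem_product, mem_biUnion, mem_sdiff, mem_singleton]
    by_cases ha : a ∈ B
    · left
      refine ⟨⟨ha, hab.1.2, fun hb => ?_⟩, hab.2⟩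
      exact htri v a b (mem_filter.1 ha).2 (mem_filter.1 hb).2 hab.2
    · exact Or.inr ⟨a, ⟨hab.1.1, ha⟩, rfl, hab.1.2, hab.2⟩
  refine (Finset.card_le_card hsub).trans ((Finset.card_union_le _ _).trans
    (Nat.add_le_add_left ?_ _))
  refine Finset.card_biUnion_le.trans ?_
  calc _ ≤ ∑ u ∈ W \ B, #B := by
        refine Finset.sum_le_sum fun u hu => ?_
        rw [card_product, card_singleton, one_mul]
        exact hmax u (mem_sdiff.1 hu).1
    _ = _ := by rw [Finset.sum_const, smul_eq_mul, mul_comm]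

/-- In a bipartite graph between `B` and `C`, few missing pairs leave few vertices of `C` that are
joined to at most about half of `B`. -/
lemma card_low_mul_le {V : Type*} [DecidableEq V] (B C : Finset V) (G : V → V → Prop)
    [DecidableRel G] :
    #{c ∈ C | 2 * #{b ∈ B | G b c} ≤ #B + 1} * (#B - 1) +
      2 * #{e ∈ B ×ˢ C | G e.1 e.2} ≤ 2 * (#B * #C) := by
  have h1 : #{e ∈ B ×ˢ C | G e.1 e.2} = ∑ c ∈ C, #{b ∈ B | G b c} := by
    simp only [Finset.card_filter, Finset.sum_product_right]
  rw [h1, Finset.card_filter, Finset.sum_mul, Finset.mul_sum, ← Finset.sum_add_distrib]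
  calc _ ≤ ∑ c ∈ C, 2 * #B := by
        refine Finset.sum_le_sum fun c _ => ?_
        have := Finset.card_filter_le B (G · c)
        split_ifs <;> omega
    _ = _ := by rw [Finset.sum_const, smul_eq_mul]; ring

namespace TripleSystem

variable {V : Type*} [Fintype V] {T : TripleSystem V}

/-- The numerical side of the structure of an extremal example: `n` vertices are split into parts
of sizes `a`, `b`, `c`, there are `q` pairs between the last two parts, and `l` exceptional
vertices. -/
lemma part_size_bounds {n a b c q l : ℝ} (hn : 10 ^ 6 ≤ n) (ha : 333 / 1000 * n ≤ a)
    (hb : 0 ≤ b) (hc : 0 ≤ c) (hsum : a + (b + c) = n)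
    (hM : (2 / 9 - 2 / 20000) * n ^ 2 ≤ q + b * c) (hq : q ≤ b * c)
    (hl : l * (b - 1) + 2 * q ≤ 2 * (b * c)) :
    a ≤ 335 / 1000 * n ∧ c ≤ 352 / 1000 * n ∧ l ≤ 5 / 1000 * n := by
  have hn0 : 0 < n := by linarith
  have hbc : b + c ≤ 667 / 1000 * n := by linarith
  have hbc_mul : (1 / 9 - 1 / 20000) * n ^ 2 ≤ b * c := by linarith
  have hamgm : 4 * (b * c) ≤ (b + c) ^ 2 := by nlinarith [sq_nonneg (b - c)]
  have hale : a ≤ 335 / 1000 * n := by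
    by_contra! hcon
    have h1 : (b + c) ^ 2 ≤ (665 / 1000 * n) ^ 2 := by
      gcongr
      linarith
    nlinarith
  have hsq : (b + c) ^ 2 ≤ (667 / 1000 * n) ^ 2 := by gcongr
  have hbge : 315 / 1000 * n ≤ b := by
    by_contra! hcon
    -- the difference `c - b` would be too large for the product `b c`
    have h1 : b * c ≤ b * (667 / 1000 * n - b) := by
      gcongr
      linarith
    nlinarith [mul_nonneg (sub_nonneg.2 hcon.le) (show 0 ≤ 352 / 1000 * n - b by linarith)]
  refine ⟨hale, by linarith, ?_⟩
  · by_contra! hcon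
    have h1 : 5 / 1000 * n * (314 / 1000 * n) ≤ l * (b - 1) :=
      mul_le_mul hcon.le (by linarith) (by linarith) (by linarith)
    nlinarith

/-- A pair of vertices that have a common neighbour pair has codegree at most two. -/
lemma F5Free.card_nbr_le_two (hT : T.F5Free) {x y z w : V} (hz : T.Rel x y z) (hw : T.Rel x y w) :
    #(T.nbr z w) ≤ 2 := by
  classical
  refine (Finset.card_le_card (t := {x, y}) fun e he => ?_).trans Finset.card_le_two
  simpa using hT hz hw (mem_nbr.1 he)

/-- The neighbourhood `A` of a pair of maximum codegree has at least about `n / 3` vertices: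
in the link of a vertex of `A`, pairs that meet `A` contribute little. -/
lemma F5Free.exists_large_nbr (hT : T.F5Free) (hn : (10 : ℝ) ^ 6 ≤ Fintype.card V)
    (hdeg : ∀ v, (2 / 9 - 1 / 20000) * (Fintype.card V : ℝ) ^ 2 ≤ T.deg v) :
    ∃ x y, (∀ u v, #(T.nbr u v) ≤ #(T.nbr x y)) ∧
      333 / 1000 * (Fintype.card V : ℝ) ≤ #(T.nbr x y) := by
  classical
  have hpos : 0 < Fintype.card V := by
    rw [← Nat.cast_pos (α := ℝ)]
    linarith
  have : Nonempty V := Fintype.card_pos_iff.1 hpos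
  obtain ⟨⟨x, y⟩, -, hmax⟩ := Finset.exists_max_image (univ : Finset (V × V))
    (fun p => #(T.nbr p.1 p.2)) univ_nonempty
  have hmax' : ∀ u v, #(T.nbr u v) ≤ #(T.nbr x y) := fun u v => hmax (u, v) (mem_univ _)
  refine ⟨x, y, hmax', ?_⟩
  set n : ℝ := (Fintype.card V : ℝ) with hndef
  set A := T.nbr x y with hA
  have hAne : A.Nonempty := by
    rw [Finset.nonempty_iff_ne_empty]
    intro h0
    have hx := hdeg x
    rw [deg_eq_sum_card_nbr, Finset.sum_eq_zero] at hx
    · push_cast at hx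
      nlinarith
    · intro w _
      have := hmax' x w
      rw [h0, card_empty] at this
      omega
  obtain ⟨z, hz⟩ := hAne
  have h1 : T.deg z ≤ 2 * #A + #(univ \ A) * #A := by
    rw [deg_eq_sum_card_nbr, ← Finset.sum_sdiff (subset_univ A), add_comm]
    refine add_le_add ?_ ?_
    · calc _ ≤ ∑ w ∈ A, 2 := Finset.sum_le_sum fun w hw =>
            hT.card_nbr_le_two (mem_nbr.1 hz) (mem_nbr.1 hw)
        _ = _ := by rw [Finset.sum_const, smul_eq_mul, mul_comm]
    · calc _ ≤ ∑ w ∈ univ \ A, #A := Finset.sum_le_sum fun w _ => hmax' z w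
        _ = _ := by rw [Finset.sum_const, smul_eq_mul]
  have h2 : (#(univ \ A) : ℝ) = n - #A := by
    have := Finset.card_sdiff_add_card_eq_card (subset_univ A)
    rw [card_univ] at this
    rw [hndef, ← this]
    push_cast
    ring
  have hAn : (#A : ℝ) ≤ n := Nat.cast_le.2 (Finset.card_le_univ A)
  rw [← Nat.cast_le (α := ℝ)] at h1
  push_cast at h1
  rw [h2] at h1
  have h3 := (hdeg z).trans h1
  by_contra! hcon
  have h4 : (0:ℝ) ≤ #A := Nat.cast_nonneg _
  -- `t ↦ t (n - t)` is increasing up to `n / 2`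
  nlinarith [mul_nonneg (sub_nonneg.2 hcon.le) (show (0:ℝ) ≤ 667 / 1000 * n - #A by linarith)]

/-- Some vertex of `A` has few link pairs of codegree at most two. -/
lemma exists_few_low_link (A : Finset V) (hA : A.Nonempty) :
    ∃ z ∈ A, #A * #{p ∈ T.link z | #(T.nbr p.1 p.2) ≤ 2} ≤ 2 * Fintype.card V ^ 2 := by
  classical
  obtain ⟨z, hz, hmin⟩ := Finset.exists_min_image A
    (fun z => #{p ∈ T.link z | #(T.nbr p.1 p.2) ≤ 2}) hA
  refine ⟨z, hz, le_trans ?_ (T.sum_card_low_link_le)⟩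
  calc _ ≤ ∑ u ∈ A, #{p ∈ T.link u | #(T.nbr p.1 p.2) ≤ 2} := by
        rw [← smul_eq_mul]
        exact Finset.card_nsmul_le_sum _ _ _ hmin
    _ ≤ _ := Finset.sum_le_sum_of_subset (subset_univ A)

/-- Almost all of the link of a vertex `z` consists of pairs of codegree at least three outside
`A`, if `z` has codegree at most two with every vertex of `A`. -/
lemma deg_le_card_high_link [DecidableEq V] (T : TripleSystem V) {z : V} (A : Finset V)
    [DecidablePred fun e : V × V => T.Rel z e.1 e.2 ∧ 2 < #(T.nbr e.1 e.2)]
    (hzA : ∀ w ∈ A, #(T.nbr z w) ≤ 2) :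
    T.deg z ≤ #{e ∈ (univ \ A) ×ˢ (univ \ A) | T.Rel z e.1 e.2 ∧ 2 < #(T.nbr e.1 e.2)} +
      #{p ∈ T.link z | #(T.nbr p.1 p.2) ≤ 2} + 4 * #A := by
  have hsub : T.link z ⊆
      ({e ∈ (univ \ A) ×ˢ (univ \ A) | T.Rel z e.1 e.2 ∧ 2 < #(T.nbr e.1 e.2)} ∪
        {p ∈ T.link z | #(T.nbr p.1 p.2) ≤ 2}) ∪
      ((A.biUnion fun w => {w} ×ˢ T.nbr z w) ∪ (A.biUnion fun w => T.nbr z w ×ˢ {w})) := by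
    rintro ⟨a, b⟩ hab
    have hab' := mem_link.1 hab
    simp only [mem_union, mem_filter, mem_product, mem_biUnion, mem_singleton, mem_nbr,
      mem_sdiff, mem_univ, true_and, hab]
    simp only at hab'
    by_cases ha : a ∈ A
    · exact Or.inr (Or.inl ⟨a, ha, rfl, hab'⟩)
    by_cases hb : b ∈ A
    · exact Or.inr (Or.inr ⟨b, hb, T.swap_right hab', rfl⟩)
    left
    by_cases h2 : #(T.nbr a b) ≤ 2
    · exact Or.inr h2
    · exact Or.inl ⟨⟨ha, hb⟩, hab', by omega⟩
  have h1 : #(A.biUnion fun w => {w} ×ˢ T.nbr z w) ≤ #A * 2 := by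
    refine Finset.card_biUnion_le.trans ?_
    rw [← smul_eq_mul]
    refine Finset.sum_le_card_nsmul _ _ _ fun w hw => ?_
    simpa using hzA w hw
  have h2 : #(A.biUnion fun w => T.nbr z w ×ˢ {w}) ≤ #A * 2 := by
    refine Finset.card_biUnion_le.trans ?_
    rw [← smul_eq_mul]
    refine Finset.sum_le_card_nsmul _ _ _ fun w hw => ?_
    simpa using hzA w hw
  have h3 := (Finset.card_le_card hsub).trans ((Finset.card_union_le _ _).trans
    (add_le_add (Finset.card_union_le _ _) (Finset.card_union_le _ _)))
  rw [deg]
  omega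

/-- An `F₅`-free `3`-graph of nearly extremal minimum degree is tripartite. The approximate parts
are the neighbourhood `A` of a pair `x y` of maximum codegree, the neighbourhood `B` of a pair `z v`
with `z ∈ A`, and the vertices outside `A ∪ B` that are joined to most of `B` in the link of `z`. -/
theorem F5Free.exists_tripartition (hT : T.F5Free) (hn : (10 : ℝ) ^ 6 ≤ Fintype.card V)
    (hdeg : ∀ v, (2 / 9 - 1 / 20000) * (Fintype.card V : ℝ) ^ 2 ≤ T.deg v) :
    ∃ p : V → Fin 3, ∀ u v w, T.Rel u v w → p u ≠ p v := by
  classical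
  obtain ⟨x, y, hmax, hlarge⟩ := hT.exists_large_nbr hn hdeg
  set n : ℝ := (Fintype.card V : ℝ) with hndef
  set A := T.nbr x y with hA
  have hAne : A.Nonempty := by
    rw [← Finset.card_pos, ← Nat.cast_pos (α := ℝ)]
    linarith
  obtain ⟨z, hz, hlow⟩ := T.exists_few_low_link A hAne
  set m := #{p ∈ T.link z | #(T.nbr p.1 p.2) ≤ 2} with hm
  let G : V → V → Prop := fun a b => T.Rel z a b ∧ 2 < #(T.nbr a b)
  have htri : ∀ a b c, G a b → G a c → ¬ G b c := fun a b c hab hac hbc =>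
    (hT.card_nbr_le_two hab.1 hac.1).not_gt hbc.2
  set W := univ \ A
  have hzA : ∀ w ∈ A, #(T.nbr z w) ≤ 2 := fun w hw =>
    hT.card_nbr_le_two (mem_nbr.1 hz) (mem_nbr.1 hw)
  have hAW : (#A : ℝ) + #W = n := by
    have := Finset.card_sdiff_add_card_eq_card (subset_univ A)
    rw [card_univ] at this
    rw [hndef, ← this]
    push_cast
    ring
  have hAn : (#A : ℝ) ≤ n := Nat.cast_le.2 (Finset.card_le_univ A)
  have hdegz : T.deg z ≤ #{e ∈ W ×ˢ W | G e.1 e.2} + m + 4 * #A :=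
    T.deg_le_card_high_link A hzA
  have hmn : (m : ℝ) ≤ 7 * n := by
    have h : (#A : ℝ) * m ≤ 2 * n ^ 2 := by
      have := hlow
      rw [← Nat.cast_le (α := ℝ)] at this
      push_cast at this
      exact this
    by_contra! hcon
    nlinarith
  have hM : (2 / 9 - 2 / 20000) * n ^ 2 ≤ (#{e ∈ W ×ˢ W | G e.1 e.2} : ℝ) := by
    have h : (T.deg z : ℝ) ≤ #{e ∈ W ×ˢ W | G e.1 e.2} + m + 4 * #A := by exact_mod_cast hdegz
    nlinarith [hdeg z]
  have hWne : W.Nonempty := by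
    rw [Finset.nonempty_iff_ne_empty]
    intro h0
    rw [h0] at hM
    simp only [empty_product, filter_empty, card_empty, Nat.cast_zero] at hM
    nlinarith
  obtain ⟨v, hv, hvM⟩ := exists_nbhd_of_triangleFree W G htri hWne
  set B := {u ∈ W | G v u} with hB
  set C := W \ B with hC
  set q := #{e ∈ B ×ˢ C | G e.1 e.2} with hq
  have hqle : q ≤ #B * #C := by
    rw [hq, ← card_product]
    exact Finset.card_filter_le _ _
  have hBW : B ⊆ W := Finset.filter_subset _ _
  have hBC : (#B : ℝ) + #C = #W := by
    have := Finset.card_sdiff_add_card_eq_card hBW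
    rw [← this]
    push_cast
    ring
  have hBA : (#B : ℝ) ≤ #A := by
    have : #B ≤ #(T.nbr z v) := Finset.card_le_card fun u hu =>
      mem_nbr.2 (mem_filter.1 hu).2.1
    exact_mod_cast this.trans (hmax z v)
  have hlowC := card_low_mul_le B C G
  set L := {c ∈ C | 2 * #{b ∈ B | G b c} ≤ #B + 1} with hL
  -- numerical consequences: the three parts have almost equal sizes, and `L` is small
  have hqle' : (q : ℝ) ≤ #B * #C := by exact_mod_cast hqle
  have hvM' : (2 / 9 - 2 / 20000) * n ^ 2 ≤ q + (#B : ℝ) * #C := by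
    refine hM.trans ?_
    exact_mod_cast hvM
  have hB1 : 1 ≤ #B := by
    by_contra! h0
    rw [Nat.lt_one_iff.1 h0, Nat.cast_zero, zero_mul, add_zero] at hvM'
    rw [Nat.lt_one_iff.1 h0, Nat.cast_zero, zero_mul] at hqle'
    nlinarith
  have hlowC' : (#L : ℝ) * (#B - 1) + 2 * q ≤ 2 * (#B * #C) := by
    have := hlowC
    rw [← Nat.cast_le (α := ℝ)] at this
    push_cast [hB1] at this
    exact this
  obtain ⟨hAle, hCle, hLle⟩ := part_size_bounds hn hlarge (Nat.cast_nonneg _) (Nat.cast_nonneg _)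
    (hBC ▸ hAW) hvM' hqle' hlowC'
  -- every hyperedge with two vertices in one of the parts `P i` contains a vertex of `S`
  let S : Finset V := {x, y, z, v}
  let P : Fin 3 → Finset V := ![A \ S, B \ S, (C \ L) \ S]
  have hle : #(P 0) ≤ #A ∧ #(P 1) ≤ #B ∧ #(P 2) ≤ #C :=
    ⟨Finset.card_le_card sdiff_subset, Finset.card_le_card sdiff_subset,
      Finset.card_le_card (sdiff_subset.trans sdiff_subset)⟩
  have hA0 : (#(P 0) : ℝ) ≤ 335 / 1000 * n := le_trans (by exact_mod_cast hle.1) hAle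
  have hB0 : (#(P 1) : ℝ) ≤ 335 / 1000 * n :=
    le_trans (by exact_mod_cast hle.2.1) (hBA.trans hAle)
  have hC0 : (#(P 2) : ℝ) ≤ 352 / 1000 * n := le_trans (by exact_mod_cast hle.2.2) hCle
  have hnS : ∀ w ∈ S, ∀ j, w ∉ P j := by
    intro w hw j
    fin_cases j
    · exact fun h => (mem_sdiff.1 h).2 hw
    · exact fun h => (mem_sdiff.1 h).2 hw
    · exact fun h => (mem_sdiff.1 h).2 hw
  have hdAB : Disjoint A B := Finset.disjoint_left.2 fun u ha hb => (mem_sdiff.1 (hBW hb)).2 ha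
  have hdAC : Disjoint A C := Finset.disjoint_left.2 fun u ha hc =>
    (mem_sdiff.1 (mem_sdiff.1 hc).1).2 ha
  have hdBC : Disjoint B C := Finset.disjoint_sdiff
  have hd01 : Disjoint (P 0) (P 1) := hdAB.mono sdiff_subset sdiff_subset
  have hd02 : Disjoint (P 0) (P 2) := hdAC.mono sdiff_subset (sdiff_subset.trans sdiff_subset)
  have hd12 : Disjoint (P 1) (P 2) := hdBC.mono sdiff_subset (sdiff_subset.trans sdiff_subset)
  refine exists_tripartition_of_parts hT hn hdeg P (L ∪ S) ?_ ?_ ?_ ?_ ?_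
  · intro u
    by_cases hS : u ∈ S
    · exact Or.inl (mem_union_right _ hS)
    by_cases hLu : u ∈ L
    · exact Or.inl (mem_union_left _ hLu)
    right
    by_cases hAu : u ∈ A
    · exact ⟨0, mem_sdiff.2 ⟨hAu, hS⟩⟩
    by_cases hBu : u ∈ B
    · exact ⟨1, mem_sdiff.2 ⟨hBu, hS⟩⟩
    · refine ⟨2, mem_sdiff.2 ⟨mem_sdiff.2 ⟨?_, hLu⟩, hS⟩⟩
      exact mem_sdiff.2 ⟨mem_sdiff.2 ⟨mem_univ _, hAu⟩, hBu⟩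
  · intro i j hij
    fin_cases i <;> fin_cases j <;>
      first
      | exact absurd rfl hij
      | exact hd01
      | exact hd02
      | exact hd12
      | exact hd01.symm
      | exact hd02.symm
      | exact hd12.symm
  · have h1 : #(L ∪ S) ≤ #L + 4 := (Finset.card_union_le _ _).trans
      (Nat.add_le_add_left Finset.card_le_four _)
    have h2 : (#(L ∪ S) : ℝ) ≤ #L + 4 := by exact_mod_cast h1
    linarith
  · have h0 : (0 : ℝ) ≤ #(P 0) := Nat.cast_nonneg _
    have h1 : (0 : ℝ) ≤ #(P 1) := Nat.cast_nonneg _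
    have h2 : (0 : ℝ) ≤ #(P 2) := Nat.cast_nonneg _
    have hn0 : 0 ≤ n := by linarith
    have key : ∀ r t : ℝ, 0 ≤ r → 0 ≤ t → r ≤ 335 / 1000 * n → t ≤ 352 / 1000 * n →
        r * t ≤ 12 / 100 * n ^ 2 := fun r t hr ht hr' ht' => by
      have := mul_le_mul hr' ht' ht (hr.trans hr')
      nlinarith [sq_nonneg n]
    intro i
    fin_cases i
    · exact key _ _ h1 h2 hB0 hC0
    · exact (mul_comm _ _).trans_le (key _ _ h0 h2 hA0 hC0)
    · exact key _ _ h0 h1 hA0 (hB0.trans (by linarith))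
  · intro i a ha b hb w hab
    apply hnS
    fin_cases i
    · have h := hT (mem_nbr.1 (mem_sdiff.1 ha).1) (mem_nbr.1 (mem_sdiff.1 hb).1) hab
      rcases h with rfl | rfl <;> simp [S]
    · have hzv : ∀ u ∈ P 1, T.Rel z v u := fun u hu =>
        (mem_filter.1 (mem_sdiff.1 hu).1).2.1
      rcases hT (hzv a ha) (hzv b hb) hab with rfl | rfl <;> simp [S]
    · -- vertices outside `L` have two common neighbours in `B`
      have hdeg2 : ∀ c ∈ P 2, #B + 1 < 2 * #{d ∈ B | G d c} := fun c hc => by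
        have h1 := mem_sdiff.1 (mem_sdiff.1 hc).1
        by_contra! h2
        exact h1.2 (mem_filter.2 ⟨h1.1, h2⟩)
      have h1 := hdeg2 a ha
      have h2 := hdeg2 b hb
      have h3 := Finset.card_union_add_card_inter {d ∈ B | G d a} {d ∈ B | G d b}
      have h4 : #({d ∈ B | G d a} ∪ {d ∈ B | G d b}) ≤ #B :=
        Finset.card_le_card (Finset.union_subset (filter_subset _ _) (filter_subset _ _))
      obtain ⟨d, hd, d', hd', hne⟩ := Finset.one_lt_card.1
        (show 1 < #({d ∈ B | G d a} ∩ {d ∈ B | G d b}) by omega)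
      simp only [mem_inter, mem_filter] at hd hd'
      have e1 := hT hd.1.2.1 hd.2.2.1 hab
      have e2 := hT hd'.1.2.1 hd'.2.2.1 hab
      have hwz : w = z := by
        rcases e1 with h | rfl
        · exact h
        · exact e2.resolve_right hne
      simp [S, hwz]

end TripleSystem

/-! ### Deleting vertices of small degree -/

lemma s_succ (n : ℕ) : s (n + 1) = s n + (n + 1) / 3 * ((n + 2) / 3) := by
  unfold s
  rw [show n + 1 + 1 = n + 2 by ring, show (n + 1 + 2) / 3 = n / 3 + 1 by omega]
  ring

namespace TripleSystem

/-- The restriction of a `3`-graph to all vertices but one. -/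
def delete {V : Type*} (T : TripleSystem V) (v : V) : TripleSystem {u // u ≠ v} where
  Rel a b c := T.Rel a b c
  swap := T.swap
  rotate := T.rotate
  ne h e := T.ne h (congrArg Subtype.val e)

variable {V : Type*} {T : TripleSystem V}

lemma F5PrimeFree.delete (hT : T.F5PrimeFree) (v : V) : (T.delete v).F5PrimeFree := by
  intro a b c d e p q h1 h2 h3 h4 h5 h6
  have h := hT h1 h2 h3 (Subtype.val_injective.ne h4) (Subtype.val_injective.ne h5) h6
  simpa [Subtype.val_inj] using h

variable [Fintype V]

open Classical in
lemma total_le_total_delete (v : V) : T.total ≤ (T.delete v).total + 3 * T.deg v := by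
  rw [total_eq_card, total_eq_card]
  have hsub : (univ : Finset (V × V × V)).filter (fun t => T.Rel t.1 t.2.1 t.2.2) ⊆
      (((univ.filter fun t : {u // u ≠ v} × {u // u ≠ v} × {u // u ≠ v} =>
          (T.delete v).Rel t.1 t.2.1 t.2.2).image fun t => (t.1.1, t.2.1.1, t.2.2.1)) ∪
        (T.link v).image fun p => (v, p.1, p.2)) ∪
      (((T.link v).image fun p => (p.1, v, p.2)) ∪ (T.link v).image fun p => (p.1, p.2, v)) := by
    rintro ⟨a, b, c⟩ h
    simp only [mem_filter, mem_univ, true_and] at h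
    simp only [mem_union, mem_image, mem_filter, mem_univ, true_and, mem_link, Prod.exists,
      Prod.mk.injEq]
    by_cases ha : a = v
    · subst ha
      exact Or.inl (Or.inr ⟨b, c, h, rfl, rfl, rfl⟩)
    by_cases hb : b = v
    · subst hb
      exact Or.inr (Or.inl ⟨a, c, T.swap h, rfl, rfl, rfl⟩)
    by_cases hc : c = v
    · subst hc
      exact Or.inr (Or.inr ⟨a, b, T.rotate (T.rotate h), rfl, rfl, rfl⟩)
    exact Or.inl (Or.inl ⟨⟨a, ha⟩, ⟨b, hb⟩, ⟨c, hc⟩, h, rfl, rfl, rfl⟩)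
  have h := (Finset.card_le_card hsub).trans ((Finset.card_union_le _ _).trans
    (add_le_add ((Finset.card_union_le _ _).trans (add_le_add card_image_le card_image_le))
      ((Finset.card_union_le _ _).trans (add_le_add card_image_le card_image_le))))
  rw [deg]
  omega

/-- If all degrees are large, then the pendant hyperedge of `F₅′` comes for free at every vertex,
so that `F₅′`-free `3`-graphs are `F₅`-free. -/
lemma F5PrimeFree.f5Free (hT : T.F5PrimeFree) (hdeg : ∀ v, 8 * Fintype.card V < T.deg v) :
    T.F5Free := by
  classical
  intro a b c d e h1 h2 h3
  by_contra! hcon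
  have hsub : T.link e ⊆ ({a, b, c, d} ×ˢ univ) ∪ (univ ×ˢ {a, b, c, d}) := by
    rintro ⟨p, q⟩ hpq
    have h := hT h1 h2 h3 hcon.1 hcon.2 (mem_link.1 hpq)
    simpa using h
  have h4 := (Finset.card_le_card hsub).trans (Finset.card_union_le _ _)
  rw [card_product, card_product, card_univ] at h4
  have h5 : #({a, b, c, d} : Finset V) ≤ 4 := Finset.card_le_four
  have h6 := hdeg e
  rw [deg] at h6
  nlinarith

/-- The upper bound on `k + 1` vertices under the assumption that no degree is smaller than
`s (k + 1) - s k`. -/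
lemma F5PrimeFree.total_le_of_le_deg (hT : T.F5PrimeFree) {k : ℕ} (hk : Fintype.card V = k + 1)
    (hk6 : 10 ^ 6 ≤ k) (hdeg : ∀ v, 2 * ((k + 1) / 3 * ((k + 2) / 3)) ≤ T.deg v) :
    T.total ≤ 6 * s (k + 1) := by
  classical
  have hk6' : (10 : ℝ) ^ 6 ≤ k := by exact_mod_cast hk6
  have hdegR : ∀ v, (2 / 9 - 1 / 20000) * (Fintype.card V : ℝ) ^ 2 ≤ T.deg v := by
    intro v
    have h1 : k ≤ 3 * ((k + 1) / 3) + 1 := by omega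
    have h2 : k ≤ 3 * ((k + 2) / 3) := by omega
    have h3 := hdeg v
    generalize (k + 1) / 3 = x at h1 h3
    generalize (k + 2) / 3 = y at h2 h3
    rw [hk]
    rw [← Nat.cast_le (α := ℝ)] at h1 h2 h3
    push_cast at h1 h2 h3 ⊢
    have h4 : ((k : ℝ) - 1) * k ≤ (3 * x) * (3 * y) :=
      mul_le_mul (by linarith) h2 (by linarith) (by positivity)
    nlinarith
  have hF5 : T.F5Free := by
    refine hT.f5Free fun v => ?_
    rw [← Nat.cast_lt (α := ℝ)]
    refine lt_of_lt_of_le ?_ (hdegR v)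
    rw [hk]
    push_cast
    nlinarith
  obtain ⟨p, hp⟩ := hF5.exists_tripartition (by rw [hk]; push_cast; linarith) hdegR
  have hsum : #{v | p v = 0} + #{v | p v = 1} + #{v | p v = 2} = k + 1 := by
    rw [← hk, ← card_univ, Finset.card_eq_sum_card_fiberwise (s := (univ : Finset V)) (f := p)
      (t := univ) (by simp), Fin.sum_univ_three]
  refine (total_le_of_tripartite p hp).trans (Nat.mul_le_mul_left _ ?_)
  rw [← hsum]
  exact mul_mul_le_s _ _ _

/-- As long as some vertex has smaller degree than in `S(n)`, deleting it increases the excess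
over `s(n)`. As the excess on `N` vertices is at most `N ^ 3`, it cannot have been positive on
more than `N + N ^ 3` vertices. -/
lemma F5PrimeFree.total_le_add {N : ℕ} (hN : 10 ^ 6 ≤ N) (j : ℕ) :
    ∀ (V : Type) [Fintype V] (T : TripleSystem V), T.F5PrimeFree → Fintype.card V = N + j →
      T.total ≤ 6 * s (N + j) + (N ^ 3 - j) := by
  classical
  induction j with
  | zero =>
    intro V _ T _ hcard
    rw [total_eq_card]
    have h := Finset.card_filter_le (univ : Finset (V × V × V)) fun t => T.Rel t.1 t.2.1 t.2.2
    rw [card_univ, Fintype.card_prod, Fintype.card_prod, hcard, add_zero] at h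
    rw [add_zero, Nat.sub_zero]
    refine h.trans (le_trans (le_of_eq (by ring)) (Nat.le_add_left _ _))
  | succ j ih =>
    intro V _ T hT hcard
    by_cases hdeg : ∀ v, 2 * ((N + j + 1) / 3 * ((N + j + 2) / 3)) ≤ T.deg v
    · exact (hT.total_le_of_le_deg (k := N + j) hcard (by omega) hdeg).trans (Nat.le_add_right _ _)
    · push Not at hdeg
      obtain ⟨v, hv⟩ := hdeg
      have h1 := ih {u // u ≠ v} (T.delete v) (hT.delete v) (by
        have := Fintype.card_subtype_compl (fun u => u = v)
        simp only [Fintype.card_subtype_eq, hcard] at this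
        simpa using this)
      have h2 := T.total_le_total_delete v
      have h3 := s_succ (N + j)
      rw [← add_assoc]
      omega

theorem F5PrimeFree.total_le {n : ℕ} (hn : 10 ^ 6 + (10 ^ 6) ^ 3 ≤ n) {V : Type} [Fintype V]
    {T : TripleSystem V} (hT : T.F5PrimeFree) (hV : Fintype.card V = n) : T.total ≤ 6 * s n := by
  obtain ⟨j, rfl⟩ : ∃ j, n = 10 ^ 6 + j := ⟨n - 10 ^ 6, by omega⟩
  have h := F5PrimeFree.total_le_add (N := 10 ^ 6) le_rfl j V T hT hV
  rwa [Nat.sub_eq_zero_of_le (by omega), add_zero] at h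

end TripleSystem

/-! ### Translation to hypergraphs, and the extremal constructions -/

lemma pair_ncard_ne_three {α : Type*} (a b : α) : ({a, b} : Set α).ncard ≠ 3 :=
  (lt_of_le_of_lt (Set.ncard_insert_le a {b}) (by simp)).ne

/-- The triple system of a `3`-graph; uniformity makes the vertices of a triple distinct. -/
def toTripleSystem {α : Type*} (H : Hypergraph α) (hH : IsThreeUniform H) : TripleSystem α where
  Rel a b c := ({a, b, c} : Set α) ∈ H.edgeSet
  swap {a b c} h := by rwa [Set.insert_comm]
  rotate {a b c} h := by rwa [Set.pair_comm c a, Set.insert_comm b a]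
  ne {a b c} h e := by
    subst e
    have := hH _ h
    rw [Set.insert_idem] at this
    exact pair_ncard_ne_three _ _ this

lemma f5PrimeFree_toTripleSystem {α : Type*} {H : Hypergraph α} (hH : IsThreeUniform H)
    (huniv : H.vertexSet = Set.univ) (hfree : ¬ ContainsCopy F5Prime H) :
    (toTripleSystem H hH).F5PrimeFree := by
  intro a b c d e p q h1 h2 h3 hea heb h6
  by_contra! hcon
  simp only [Set.mem_insert_iff, Set.mem_singleton_iff, not_or] at hcon
  obtain ⟨⟨hpa, hpb, hpc, hpd⟩, hqa, hqb, hqc, hqd⟩ := hcon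
  set T := toTripleSystem H hH
  have n1 := T.ne h1
  have n2 := T.ne (T.rotate h1)
  have n3 := T.ne (T.rotate (T.rotate h1))
  have n4 := T.ne (T.rotate h2)
  have n5 := T.ne (T.rotate (T.rotate h2))
  have n6 := T.ne h3
  have n7 := T.ne (T.rotate h3)
  have n8 := T.ne (T.rotate (T.rotate h3))
  have n9 := T.ne h6
  have n10 := T.ne (T.rotate h6)
  have n11 := T.ne (T.rotate (T.rotate h6))
  let f : ℕ → α := fun i => if i = 1 then a else if i = 2 then b else if i = 3 then c else
    if i = 4 then d else if i = 5 then e else if i = 6 then p else q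
  have f1 : f 1 = a := rfl
  have f2 : f 2 = b := rfl
  have f3 : f 3 = c := rfl
  have f4 : f 4 = d := rfl
  have f5 : f 5 = e := rfl
  have f6 : f 6 = p := rfl
  have f7 : f 7 = q := rfl
  refine hfree ⟨f, ?_, fun _ _ => huniv ▸ Set.mem_univ _, ?_⟩
  · rintro i (rfl | rfl | rfl | rfl | rfl | rfl | rfl) j
      (rfl | rfl | rfl | rfl | rfl | rfl | rfl) hij <;>
    first
    | rfl
    | (exfalso
       simp only [f1, f2, f3, f4, f5, f6, f7] at hij
       subst hij
       contradiction)
  · rintro s (rfl | rfl | rfl | rfl) <;>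
      simp only [Set.image_insert_eq, Set.image_singleton, f1, f2, f3, f4, f5, f6, f7]
    · exact h1
    · exact h2
    · exact h3
    · exact T.rotate h6

/-- Every hyperedge gives rise to six ordered triples. -/
lemma six_mul_ncard_le_total {α : Type*} [Fintype α] {H : Hypergraph α} (hH : IsThreeUniform H) :
    6 * H.edgeSet.ncard ≤ (toTripleSystem H hH).total := by
  classical
  rw [TripleSystem.total_eq_card, Set.ncard_eq_toFinset_card', mul_comm]
  let F : α × α × α → Set α := fun t => {t.1, t.2.1, t.2.2}
  rw [Finset.card_eq_sum_card_fiberwise (f := F) (t := H.edgeSet.toFinset)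
    (s := univ.filter fun t => (toTripleSystem H hH).Rel t.1 t.2.1 t.2.2)]
  · rw [← smul_eq_mul]
    refine Finset.card_nsmul_le_sum _ _ _ fun e he => ?_
    rw [Set.mem_toFinset] at he
    obtain ⟨a, b, c, hab, hac, hbc, rfl⟩ := Set.ncard_eq_three.1 (hH e he)
    have h6 : #({(a, b, c), (a, c, b), (b, a, c), (b, c, a), (c, a, b), (c, b, a)} :
        Finset (α × α × α)) = 6 := by
      simp [Finset.card_insert_of_notMem, hab, hac, hbc, hab.symm, hac.symm, hbc.symm]
    rw [← h6]
    refine Finset.card_le_card fun t ht => ?_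
    have hperm : ({t.1, t.2.1, t.2.2} : Set α) = {a, b, c} := by
      simp only [mem_insert, mem_singleton] at ht
      rcases ht with rfl | rfl | rfl | rfl | rfl | rfl
      · rfl
      · exact congrArg (insert a) (Set.pair_comm c b)
      · exact Set.insert_comm b a {c}
      · exact (congrArg (insert b) (Set.pair_comm c a)).trans (Set.insert_comm b a {c})
      · exact (Set.insert_comm c a {b}).trans (congrArg (insert a) (Set.pair_comm c b))
      · exact (congrArg (insert c) (Set.pair_comm b a)).trans
          ((Set.insert_comm c a {b}).trans (congrArg (insert a) (Set.pair_comm c b)))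
    simp only [mem_filter, mem_univ, true_and]
    exact ⟨(congrArg (· ∈ H.edgeSet) hperm).mpr he, hperm⟩
  · intro t ht
    simp only [coe_filter, mem_univ, true_and, Set.mem_ofPred_eq] at ht
    exact Finset.mem_coe.2 (Set.mem_toFinset.2 ht)

lemma containsCopy_F5_F5Prime : ContainsCopy F5 F5Prime := by
  refine ⟨id, Set.injOn_id _, ?_, ?_⟩
  · rintro i (rfl | rfl | rfl | rfl | rfl) <;> simp [F5Prime]
  · rintro e (rfl | rfl | rfl) <;> simp [F5Prime]

/-- The three vertices of a hyperedge of `S n` lie in three different parts. -/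
lemma part_ne_of_mem_S {n : ℕ} {a b c : Fin n} (h : ({a, b, c} : Set (Fin n)) ∈ (S n).edgeSet) :
    part a ≠ part b ∧ part a ≠ part c ∧ part b ≠ part c := by
  obtain ⟨x, y, z, hx, hy, hz, he⟩ := h
  have h1 : x ∈ ({a, b, c} : Set (Fin n)) := he ▸ by simp
  have h2 : y ∈ ({a, b, c} : Set (Fin n)) := he ▸ by simp
  have h3 : z ∈ ({a, b, c} : Set (Fin n)) := he ▸ by simp
  simp only [Set.mem_insert_iff, Set.mem_singleton_iff] at h1 h2 h3
  rcases h1 with rfl | rfl | rfl <;> rcases h2 with rfl | rfl | rfl <;>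
    rcases h3 with rfl | rfl | rfl <;> omega

/-- There is not even a homomorphism from `F₅` to `S n`: the hyperedges `123` and `124` force the
images of `3` and `4` into one part. -/
lemma not_F5_hom_S {n : ℕ} {a b c d e : Fin n} (h1 : ({a, b, c} : Set (Fin n)) ∈ (S n).edgeSet)
    (h2 : ({a, b, d} : Set (Fin n)) ∈ (S n).edgeSet)
    (h3 : ({c, d, e} : Set (Fin n)) ∈ (S n).edgeSet) : False := by
  have p1 := part_ne_of_mem_S h1
  have p2 := part_ne_of_mem_S h2
  have p3 := part_ne_of_mem_S h3
  have hlt : ∀ x : Fin n, part x < 3 := fun x => Nat.mod_lt _ (by norm_num)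
  have := hlt a
  have := hlt b
  have := hlt c
  have := hlt d
  omega

lemma isThreeUniform_S (n : ℕ) : IsThreeUniform (S n) := by
  rintro e ⟨x, y, z, hx, hy, hz, rfl⟩
  refine Set.ncard_eq_three.2 ⟨x, y, z, ?_, ?_, ?_, rfl⟩ <;> rintro rfl <;> omega

lemma not_containsCopy_F5Prime_S (n : ℕ) : ¬ ContainsCopy F5Prime (S n) := by
  rintro ⟨f, -, -, hedge⟩
  have h1 := hedge {1, 2, 3} (by simp [F5Prime])
  have h2 := hedge {1, 2, 4} (by simp [F5Prime])
  have h3 := hedge {3, 4, 5} (by simp [F5Prime])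
  simp only [Set.image_insert_eq, Set.image_singleton] at h1 h2 h3
  exact not_F5_hom_S h1 h2 h3

/-- The hyperedges `{3i, 3j + 1, 3k + 2}` of `S n` are pairwise distinct. -/
lemma s_le_ncard_edgeSet_S (n : ℕ) : s n ≤ (S n).edgeSet.ncard := by
  let f : Fin ((n + 2) / 3) × Fin ((n + 1) / 3) × Fin (n / 3) → Set (Fin n) := fun t =>
    {⟨3 * t.1, by omega⟩, ⟨3 * t.2.1 + 1, by omega⟩, ⟨3 * t.2.2 + 2, by omega⟩}
  have hf : Function.Injective f := by
    rintro ⟨i, j, k⟩ ⟨i', j', k'⟩ h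
    have h1 : (⟨3 * i, by omega⟩ : Fin n) ∈ f (i', j', k') := h ▸ by simp [f]
    have h2 : (⟨3 * j + 1, by omega⟩ : Fin n) ∈ f (i', j', k') := h ▸ by simp [f]
    have h3 : (⟨3 * k + 2, by omega⟩ : Fin n) ∈ f (i', j', k') := h ▸ by simp [f]
    simp only [f, Set.mem_insert_iff, Set.mem_singleton_iff, Fin.mk.injEq] at h1 h2 h3
    simp only [Prod.mk.injEq, Fin.ext_iff]
    omega
  have hsub : Set.range f ⊆ (S n).edgeSet := by
    rintro _ ⟨t, rfl⟩
    exact ⟨_, _, _, by simp [part], by simp [part], by simp [part], rfl⟩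
  have hcard : (Set.range f).ncard = s n := by
    rw [← Set.image_univ, Set.ncard_image_of_injective _ hf, Set.ncard_univ]
    simp [s]
    ring
  rw [← hcard]
  exact Set.ncard_le_ncard hsub

/-- A copy of `F₅′` cannot use the new vertex of `S⁺(m)`, which lies in only one hyperedge, as one
of `1, …, 5`; hence it yields a copy of `F₅` in `S(m - 1)`. -/
lemma not_containsCopy_F5Prime_SPlus (m : ℕ) (x y : Fin (m - 1)) :
    ¬ ContainsCopy F5Prime (SPlus m x y) := by
  rintro ⟨f, hinj, -, hedge⟩
  have h1 := hedge {1, 2, 3} (by simp [F5Prime])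
  have h2 := hedge {1, 2, 4} (by simp [F5Prime])
  have h3 := hedge {3, 4, 5} (by simp [F5Prime])
  have h4 := hedge {6, 7, 5} (by simp [F5Prime])
  have hnew : ∀ e ∈ (SPlus m x y).edgeSet, none ∈ e → e = {none, some x, some y} := by
    rintro e (⟨d, -, rfl⟩ | he) hn
    · simp at hn
    · exact he
  have hold : ∀ e ∈ (SPlus m x y).edgeSet, none ∉ e → ∃ d ∈ (S (m - 1)).edgeSet, e = some '' d := by
    rintro e (he | rfl) hn
    · exact he
    · simp at hn
  -- `i` lies in two hyperedges `e`, `e'`, and `k ∈ e'` distinguishes them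
  have hne : ∀ (i k : ℕ) (e e' : Set ℕ), f '' e ∈ (SPlus m x y).edgeSet →
      f '' e' ∈ (SPlus m x y).edgeSet → i ∈ e → i ∈ e' → k ∈ e' → e ⊆ F5Prime.vertexSet →
      k ∈ F5Prime.vertexSet → k ∉ e → f i ≠ none := by
    intro i k e e' he he' hi hi' hk heF hkF hke hfi
    have h5 := hnew _ he ⟨i, hi, hfi⟩
    have h6 := hnew _ he' ⟨i, hi', hfi⟩
    obtain ⟨l, hl, hlk⟩ : f k ∈ f '' e := by
      rw [h5, ← h6]
      exact ⟨k, hk, rfl⟩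
    exact hke (hinj (heF hl) hkF hlk ▸ hl)
  have n1 : f 1 ≠ none := hne 1 4 _ _ h1 h2 (by simp) (by simp) (by simp)
    (by simp [Set.insert_subset_iff, F5Prime]) (by simp [F5Prime]) (by simp)
  have n2 : f 2 ≠ none := hne 2 4 _ _ h1 h2 (by simp) (by simp) (by simp)
    (by simp [Set.insert_subset_iff, F5Prime]) (by simp [F5Prime]) (by simp)
  have n3 : f 3 ≠ none := hne 3 4 _ _ h1 h3 (by simp) (by simp) (by simp)
    (by simp [Set.insert_subset_iff, F5Prime]) (by simp [F5Prime]) (by simp)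
  have n4 : f 4 ≠ none := hne 4 3 _ _ h2 h3 (by simp) (by simp) (by simp)
    (by simp [Set.insert_subset_iff, F5Prime]) (by simp [F5Prime]) (by simp)
  have n5 : f 5 ≠ none := hne 5 6 _ _ h3 h4 (by simp) (by simp) (by simp)
    (by simp [Set.insert_subset_iff, F5Prime]) (by simp [F5Prime]) (by simp)
  obtain ⟨a, ha⟩ := Option.ne_none_iff_exists'.1 n1
  obtain ⟨b, hb⟩ := Option.ne_none_iff_exists'.1 n2
  obtain ⟨c, hc⟩ := Option.ne_none_iff_exists'.1 n3
  obtain ⟨d, hd⟩ := Option.ne_none_iff_exists'.1 n4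
  obtain ⟨e, he⟩ := Option.ne_none_iff_exists'.1 n5
  simp only [Set.image_insert_eq, Set.image_singleton, ha, hb, hc, hd, he] at h1 h2 h3
  have hS : ∀ u v w : Fin (m - 1), ({some u, some v, some w} : Set _) ∈ (SPlus m x y).edgeSet →
      ({u, v, w} : Set _) ∈ (S (m - 1)).edgeSet := by
    intro u v w huvw
    obtain ⟨t, ht, hte⟩ := hold _ huvw (by simp)
    have : some '' ({u, v, w} : Set (Fin (m - 1))) = some '' t := by
      rw [← hte, Set.image_insert_eq, Set.image_insert_eq, Set.image_singleton]
    rwa [(Option.some_injective _).image_injective this]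
  exact not_F5_hom_S (hS _ _ _ h1) (hS _ _ _ h2) (hS _ _ _ h3)

lemma containsCopy_F5Prime_blowUp : ContainsCopy F5Prime (blowUp F5 2) := by
  let f : ℕ → ℕ × Fin 2 := fun i => if i = 6 then (3, 1) else if i = 7 then (4, 1) else (i, 0)
  refine ⟨f, ?_, ?_, ?_⟩
  · rintro i (rfl | rfl | rfl | rfl | rfl | rfl | rfl) j
      (rfl | rfl | rfl | rfl | rfl | rfl | rfl) hij <;> first | rfl | simp [f] at hij
  · rintro i (rfl | rfl | rfl | rfl | rfl | rfl | rfl) <;> simp [f, blowUp, F5]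
  · rintro e (rfl | rfl | rfl | rfl)
    · refine ⟨?_, ?_⟩
      · simp [f, Set.InjOn, Set.image_insert_eq]
      · simp [f, Set.image_insert_eq, F5]
    · refine ⟨?_, ?_⟩
      · simp [f, Set.InjOn, Set.image_insert_eq]
      · simp [f, Set.image_insert_eq, F5]
    · refine ⟨?_, ?_⟩
      · simp [f, Set.InjOn, Set.image_insert_eq]
      · simp [f, Set.image_insert_eq, F5]
    · refine ⟨?_, ?_⟩
      · simp [f, Set.InjOn, Set.image_insert_eq]
      · simp [f, Set.image_insert_eq, F5]

theorem ex_F5Prime_eq {n : ℕ} (hn : 10 ^ 6 + (10 ^ 6) ^ 3 ≤ n) : ex n F5Prime = s n := by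
  have hgreatest := isGreatest_ex n F5Prime ⟨{1, 2, 3}, by simp [F5Prime]⟩
  refine le_antisymm ?_ ?_
  · obtain ⟨H, huniv, hH, hfree, hcard⟩ := hgreatest.1
    have h1 := (f5PrimeFree_toTripleSystem hH huniv hfree).total_le hn (Fintype.card_fin n)
    have h2 := six_mul_ncard_le_total hH
    omega
  · exact (s_le_ncard_edgeSet_S n).trans (hgreatest.2
      ⟨S n, rfl, isThreeUniform_S n, not_containsCopy_F5Prime_S n, rfl⟩)

end ThreeGraphs

theorem mainTheorem6 :
    (ThreeGraphs.ContainsCopy ThreeGraphs.F5 ThreeGraphs.F5Prime ∧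
      ThreeGraphs.ContainsCopy ThreeGraphs.F5Prime (ThreeGraphs.blowUp ThreeGraphs.F5 2)) ∧
    (∀ m : ℕ, 1 ≤ m → ∀ x y : Fin (m - 1), x ≠ y → ThreeGraphs.part x = ThreeGraphs.part y →
      ¬ ThreeGraphs.ContainsCopy ThreeGraphs.F5Prime (ThreeGraphs.SPlus m x y)) ∧
    (∃ N : ℕ, ∀ n : ℕ, N ≤ n → ThreeGraphs.ex n ThreeGraphs.F5Prime = ThreeGraphs.s n) :=
  ⟨⟨ThreeGraphs.containsCopy_F5_F5Prime, ThreeGraphs.containsCopy_F5Prime_blowUp⟩,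
    fun m _ x y _ _ => ThreeGraphs.not_containsCopy_F5Prime_SPlus m x y,
    ⟨10 ^ 6 + (10 ^ 6) ^ 3, fun _ hn => ThreeGraphs.ex_F5Prime_eq hn⟩⟩
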